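/- Let $\mathsf{RCA}_0^\omega$ be Kohlenbach's base theory of higher-order Reverse Mathematics, formulated in classical many-sorted predicate logic over all finite types (type $0$ is $\mathbb N$, type $1$ is $0\to 0$, type $2$ is $1\to 0$), with equality at higher types defined extensionally. Its axioms are: the ordered semi-ring axioms for $0,1,<_0,+_0,\times_0,=_0$; the axioms of the combinators $\Pi,\Sigma$; the defining equations of the recursor $\mathbf R_0$; extensionality for all finite types; induction for quantifier-free formulas; and quantifier-free choice $\mathsf{QF\text{-}AC}^{1,0}$, i.e. $(\forall x^1)(\exists y^0)A(x,y)\to(\exists Y^2)(\forall x^1)A(x,Y(x))$ for quantifier-free $A$. In $\mathsf{RCA}_0^\omega$, write $x\in 2^{\mathbb N}$ for $x\le_1 1$ and $\overline{x}k$ for (the number coding) the finite binary sequence $\langle x(0),\dots,x(k-1)\rangle$. Sets of tuples of numbers are given by characteristic functions. A code of an RM-closed set $D\subseteq 2^{\mathbb N}$ is a set $U$ of pairs $(n,c)$, where $$x\in D\;:\Longleftrightarrow\;\neg(\exists n)(\exists k)\,\big((n,\overline{x}k)\in U\big)\qquad(x\in 2^{\mathbb N}).$$ An RM-code of a continuous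 partial function $f$ from $2^{\mathbb N}$ to $\mathbb N$ is a set $F$ of triples $(i,c,m)$ such that, writing $c\,F\,m$ for $(\exists i)((i,c,m)\in F)$, for all finite binary sequences $c,d$ and all $m,m'\in\mathbb N$: (1) $c\,F\,m$ and $c\,F\,m'$ imply $m=m'$; (2) $c\,F\,m$ implies $d\,F\,m$ whenever $d$ extends $c$. For $x\in2^{\mathbb N}$, $f(x)=m$ means $(\exists k)(\overline{x}k\,F\,m)$, and "$f(x)$ is defined" means $(\exists m)(f(x)=m)$. **Theorem.** $\mathsf{RCA}_0^\omega$ proves the following. Let $D\subseteq 2^{\mathbb N}$ be an RM-closed set, given by a code, and let $f$ be an RM-code of a continuous partial function from $2^{\mathbb N}$ to $\mathbb N$. If $$(\forall x\in 2^{\mathbb N})\big(x\in D\leftrightarrow f(x)\text{ is defined}\big),$$ then membership in $D$ is decidable: there is a functional $\Phi^2$ such that $$(\forall x\in 2^{\mathbb N})\big(x\in D\leftrightarrow \Phi(x)=0\big).$$ -/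

import Mathlib

/-!
# Higher-order arithmetic and the base theory `RCA₀^ω`

The language of higher-order arithmetic is a many-sorted language whose sorts are the finite types.
Terms and formulas are intrinsically typed, with de Bruijn variables; terms contain no binders, as
abstraction is expressed through the combinators `Π` and `Σ`.  Provability is natural deduction for
classical many-sorted predicate logic.
-/

namespace HigherOrderArithmetic

/-! ## The language -/

/-- The finite types: `0`, and `σ → τ` for finite types `σ` and `τ`. -/
inductive Ty : Type
  | nat : Ty
  | arr : Ty → Ty → Ty

infixr:60 " ⇾ " => Ty.arr

/-- The type `0` of natural numbers. -/
abbrev T0 : Ty := Ty.nat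
/-- The type `1` of functions from numbers to numbers. -/
abbrev T1 : Ty := T0 ⇾ T0
/-- The type `2` of functionals from type `1` objects to numbers. -/
abbrev T2 : Ty := T1 ⇾ T0

/-- A context: the types of the free variables, the most recently bound one first. -/
abbrev Ctx : Type := List Ty

/-- The variables of type `σ` in a context. -/
inductive Var : Ctx → Ty → Type
  | vz {Γ : Ctx} {σ : Ty} : Var (σ :: Γ) σ
  | vs {Γ : Ctx} {σ τ : Ty} : Var Γ σ → Var (τ :: Γ) σ

/-- The constants of the language: `0`, `1`, `+`, `×`, the combinators `Π` and `Σ`, and the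
recursors.  The relations `<` and `=` at type `0` are atomic formulas, see `Fm`. -/
inductive Const : Ty → Type
  | zero : Const T0
  | one : Const T0
  | add : Const (T0 ⇾ T0 ⇾ T0)
  | mul : Const (T0 ⇾ T0 ⇾ T0)
  | combP (ρ τ : Ty) : Const (ρ ⇾ τ ⇾ ρ)
  | combS (δ ρ τ : Ty) : Const ((δ ⇾ ρ ⇾ τ) ⇾ (δ ⇾ ρ) ⇾ δ ⇾ τ)
  | recur (σ : Ty) : Const ((T0 ⇾ σ ⇾ σ) ⇾ σ ⇾ T0 ⇾ σ)

/-- The terms of a given type in a given context. -/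
inductive Tm : Ctx → Ty → Type
  | var {Γ : Ctx} {σ : Ty} : Var Γ σ → Tm Γ σ
  | const {Γ : Ctx} {σ : Ty} : Const σ → Tm Γ σ
  | app {Γ : Ctx} {σ τ : Ty} : Tm Γ (σ ⇾ τ) → Tm Γ σ → Tm Γ τ

infixl:75 " ⬝ " => Tm.app

namespace Tm

/-- Simultaneous substitution of terms for variables. -/
def subst {Γ Δ : Ctx} (θ : ∀ {σ : Ty}, Var Γ σ → Tm Δ σ) : {σ : Ty} → Tm Γ σ → Tm Δ σ
  | _, var v => θ v
  | _, const c => const c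
  | _, app s t => app (subst θ s) (subst θ t)

/-- Weakening: a term in a context is also a term in a context with one more variable. -/
def wk {Γ : Ctx} {ρ σ : Ty} (t : Tm Γ σ) : Tm (ρ :: Γ) σ :=
  t.subst (fun v => var (Var.vs v))

/-- The most recently bound variable. -/
abbrev v0 {Γ : Ctx} {σ : Ty} : Tm (σ :: Γ) σ := var Var.vz
/-- The variable bound just before `v0`. -/
abbrev v1 {Γ : Ctx} {σ τ : Ty} : Tm (τ :: σ :: Γ) σ := var (Var.vs Var.vz)
/-- The variable bound just before `v1`. -/
abbrev v2 {Γ : Ctx} {σ τ ρ : Ty} : Tm (ρ :: τ :: σ :: Γ) σ := var (Var.vs (Var.vs Var.vz))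
/-- The variable bound just before `v2`. -/
abbrev v3 {Γ : Ctx} {σ τ ρ δ : Ty} : Tm (δ :: ρ :: τ :: σ :: Γ) σ :=
  var (Var.vs (Var.vs (Var.vs Var.vz)))
/-- The variable bound just before `v3`. -/
abbrev v4 {Γ : Ctx} {σ τ ρ δ ε : Ty} : Tm (ε :: δ :: ρ :: τ :: σ :: Γ) σ :=
  var (Var.vs (Var.vs (Var.vs (Var.vs Var.vz))))

/-- The term `0`. -/
abbrev zero {Γ : Ctx} : Tm Γ T0 := const Const.zero
/-- The term `1`. -/
abbrev one {Γ : Ctx} : Tm Γ T0 := const Const.one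
/-- The term `s + t`. -/
abbrev add {Γ : Ctx} (s t : Tm Γ T0) : Tm Γ T0 := const Const.add ⬝ s ⬝ t
/-- The term `s × t`. -/
abbrev mul {Γ : Ctx} (s t : Tm Γ T0) : Tm Γ T0 := const Const.mul ⬝ s ⬝ t
/-- The term `t + 1`. -/
abbrev succ {Γ : Ctx} (t : Tm Γ T0) : Tm Γ T0 := add t one

/-- Abstraction `λx. t` over the most recently bound variable, through the combinators:
`λx. x` is `Σ Π Π`, `λx. a` is `Π a` if `a` is another variable or a constant, and `λx. s t` is
`Σ (λx. s) (λx. t)`. -/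
def lam {Γ : Ctx} {σ : Ty} : {τ : Ty} → Tm (σ :: Γ) τ → Tm Γ (σ ⇾ τ)
  | _, var Var.vz =>
      const (Const.combS σ (σ ⇾ σ) σ) ⬝ const (Const.combP σ (σ ⇾ σ)) ⬝ const (Const.combP σ σ)
  | τ, var (Var.vs v) => const (Const.combP τ σ) ⬝ var v
  | τ, const c => const (Const.combP τ σ) ⬝ const c
  | τ, @app _ ρ _ s t => const (Const.combS σ ρ τ) ⬝ lam s ⬝ lam t

end Tm

/-- The formulas in a given context.  The atomic formulas are the equations and inequalities between
terms of type `0`. -/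
inductive Fm : Ctx → Type
  | eq {Γ : Ctx} : Tm Γ T0 → Tm Γ T0 → Fm Γ
  | lt {Γ : Ctx} : Tm Γ T0 → Tm Γ T0 → Fm Γ
  | bot {Γ : Ctx} : Fm Γ
  | imp {Γ : Ctx} : Fm Γ → Fm Γ → Fm Γ
  | and {Γ : Ctx} : Fm Γ → Fm Γ → Fm Γ
  | or {Γ : Ctx} : Fm Γ → Fm Γ → Fm Γ
  | all {Γ : Ctx} (σ : Ty) : Fm (σ :: Γ) → Fm Γ
  | ex {Γ : Ctx} (σ : Ty) : Fm (σ :: Γ) → Fm Γ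

/-- Extension of a substitution under a binder. -/
def liftSubst {Γ Δ : Ctx} (θ : ∀ {σ : Ty}, Var Γ σ → Tm Δ σ) {ρ : Ty} :
    ∀ {σ : Ty}, Var (ρ :: Γ) σ → Tm (ρ :: Δ) σ
  | _, Var.vz => Tm.var Var.vz
  | _, Var.vs v => (θ v).wk

/-- The substitution that sends the most recently bound variable to `t`, and fixes the others. -/
def instSubst {Γ : Ctx} {ρ : Ty} (t : Tm Γ ρ) : ∀ {σ : Ty}, Var (ρ :: Γ) σ → Tm Γ σ
  | _, Var.vz => t
  | _, Var.vs v => Tm.var v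

namespace Fm

/-- Negation. -/
abbrev neg {Γ : Ctx} (A : Fm Γ) : Fm Γ := A.imp bot
/-- Equivalence. -/
abbrev iff {Γ : Ctx} (A B : Fm Γ) : Fm Γ := (A.imp B).and (B.imp A)
/-- The formula `s ≤ t` between terms of type `0`. -/
abbrev le {Γ : Ctx} (s t : Tm Γ T0) : Fm Γ := (lt s t).or (eq s t)

/-- Simultaneous (capture-avoiding) substitution of terms for the free variables of a formula. -/
def subst : {Γ Δ : Ctx} → (∀ {σ : Ty}, Var Γ σ → Tm Δ σ) → Fm Γ → Fm Δ
  | _, _, θ, eq s t => eq (s.subst θ) (t.subst θ)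
  | _, _, θ, lt s t => lt (s.subst θ) (t.subst θ)
  | _, _, _, bot => bot
  | _, _, θ, imp A B => imp (A.subst θ) (B.subst θ)
  | _, _, θ, and A B => and (A.subst θ) (B.subst θ)
  | _, _, θ, or A B => or (A.subst θ) (B.subst θ)
  | _, _, θ, all σ A => all σ (A.subst (liftSubst θ))
  | _, _, θ, ex σ A => ex σ (A.subst (liftSubst θ))

/-- Weakening of a formula to a context with one more variable. -/
def wk {Γ : Ctx} {ρ : Ty} (A : Fm Γ) : Fm (ρ :: Γ) := A.subst (fun v => Tm.var (Var.vs v))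

/-- `A[t]`: substitution of `t` for the most recently bound variable. -/
def inst {Γ : Ctx} {ρ : Ty} (A : Fm (ρ :: Γ)) (t : Tm Γ ρ) : Fm Γ := A.subst (instSubst t)

/-- Quantifier-free formulas; variables of all finite types may occur. -/
def QF : {Γ : Ctx} → Fm Γ → Prop
  | _, eq _ _ => True
  | _, lt _ _ => True
  | _, bot => True
  | _, imp A B => A.QF ∧ B.QF
  | _, and A B => A.QF ∧ B.QF
  | _, or A B => A.QF ∧ B.QF
  | _, all _ _ => False
  | _, ex _ _ => False

/-- Equality at type `τ = (τ₁ → ⋯ → τₖ → 0)`: `s =_τ t` is `∀ z₁ ⋯ zₖ, s z₁ ⋯ zₖ =₀ t z₁ ⋯ zₖ`. -/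
def eqT : {Γ : Ctx} → (τ : Ty) → Tm Γ τ → Tm Γ τ → Fm Γ
  | _, Ty.nat, s, t => eq s t
  | _, Ty.arr σ τ, s, t => all σ (eqT τ (s.wk ⬝ Tm.v0) (t.wk ⬝ Tm.v0))

end Fm

/-! ## Provability -/

/-- A theory, given by its axioms.  An axiom with free variables stands for its universal closure
(the two are interderivable by the rules for `∀`). -/
abbrev Theory : Type := (Γ : Ctx) → Fm Γ → Prop

/-- `Proves T Δ A`: the formula `A` has a natural deduction from the axioms of `T` and the hypotheses
`Δ`, in classical many-sorted predicate logic. -/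
inductive Proves (T : Theory) : {Γ : Ctx} → Set (Fm Γ) → Fm Γ → Prop
  | ax {Γ : Ctx} {Δ : Set (Fm Γ)} {A : Fm Γ} : T Γ A → Proves T Δ A
  | hyp {Γ : Ctx} {Δ : Set (Fm Γ)} {A : Fm Γ} : A ∈ Δ → Proves T Δ A
  | impI {Γ : Ctx} {Δ : Set (Fm Γ)} {A B : Fm Γ} :
      Proves T (insert A Δ) B → Proves T Δ (A.imp B)
  | impE {Γ : Ctx} {Δ : Set (Fm Γ)} {A B : Fm Γ} :
      Proves T Δ (A.imp B) → Proves T Δ A → Proves T Δ B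
  | andI {Γ : Ctx} {Δ : Set (Fm Γ)} {A B : Fm Γ} :
      Proves T Δ A → Proves T Δ B → Proves T Δ (A.and B)
  | andE₁ {Γ : Ctx} {Δ : Set (Fm Γ)} {A B : Fm Γ} : Proves T Δ (A.and B) → Proves T Δ A
  | andE₂ {Γ : Ctx} {Δ : Set (Fm Γ)} {A B : Fm Γ} : Proves T Δ (A.and B) → Proves T Δ B
  | orI₁ {Γ : Ctx} {Δ : Set (Fm Γ)} {A B : Fm Γ} : Proves T Δ A → Proves T Δ (A.or B)
  | orI₂ {Γ : Ctx} {Δ : Set (Fm Γ)} {A B : Fm Γ} : Proves T Δ B → Proves T Δ (A.or B)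
  | orE {Γ : Ctx} {Δ : Set (Fm Γ)} {A B C : Fm Γ} :
      Proves T Δ (A.or B) → Proves T (insert A Δ) C → Proves T (insert B Δ) C → Proves T Δ C
  | raa {Γ : Ctx} {Δ : Set (Fm Γ)} {A : Fm Γ} :
      Proves T (insert A.neg Δ) Fm.bot → Proves T Δ A
  | allI {Γ : Ctx} {Δ : Set (Fm Γ)} {σ : Ty} {A : Fm (σ :: Γ)} :
      Proves T (Fm.wk '' Δ) A → Proves T Δ (Fm.all σ A)
  | allE {Γ : Ctx} {Δ : Set (Fm Γ)} {σ : Ty} {A : Fm (σ :: Γ)} (t : Tm Γ σ) :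
      Proves T Δ (Fm.all σ A) → Proves T Δ (A.inst t)
  | exI {Γ : Ctx} {Δ : Set (Fm Γ)} {σ : Ty} {A : Fm (σ :: Γ)} (t : Tm Γ σ) :
      Proves T Δ (A.inst t) → Proves T Δ (Fm.ex σ A)
  | exE {Γ : Ctx} {Δ : Set (Fm Γ)} {σ : Ty} {A : Fm (σ :: Γ)} {C : Fm Γ} :
      Proves T Δ (Fm.ex σ A) → Proves T (insert A (Fm.wk '' Δ)) C.wk → Proves T Δ C

/-! ## The base theory -/

/-- In a context that ends in `n⁰`: the substitution `n ↦ n + 1`. -/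
def succSubst {Γ : Ctx} : ∀ {σ : Ty}, Var (T0 :: Γ) σ → Tm (T0 :: Γ) σ
  | _, Var.vz => Tm.succ Tm.v0
  | _, Var.vs v => Tm.var (Var.vs v)

/-- From a context that ends in `x¹, y⁰` to one that ends in `Y², x¹`: the substitution
`y ↦ Y(x)`. -/
def choiceSubst {Γ : Ctx} : ∀ {σ : Ty}, Var (T0 :: T1 :: Γ) σ → Tm (T1 :: T2 :: Γ) σ
  | _, Var.vz => Tm.v1 ⬝ Tm.v0
  | _, Var.vs Var.vz => Tm.v0
  | _, Var.vs (Var.vs v) => Tm.var (Var.vs (Var.vs v))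

open Tm in
/-- The axioms of Kohlenbach's base theory `RCA₀^ω` of higher-order Reverse Mathematics. -/
inductive RCA0omega : Theory
  -- `=₀` is an equality relation
  | eq_refl {Γ : Ctx} (r : Tm Γ T0) : RCA0omega Γ (.eq r r)
  | eq_symm {Γ : Ctx} (r s : Tm Γ T0) : RCA0omega Γ ((Fm.eq r s).imp (.eq s r))
  | eq_trans {Γ : Ctx} (r s t : Tm Γ T0) :
      RCA0omega Γ ((Fm.eq r s).imp ((Fm.eq s t).imp (.eq r t)))
  | lt_congr {Γ : Ctx} (r r' s s' : Tm Γ T0) :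
      RCA0omega Γ ((Fm.eq r r').imp ((Fm.eq s s').imp ((Fm.lt r s).imp (.lt r' s'))))
  -- `0, 1, <, +, ×` form a (commutative, discretely) ordered semi-ring with least element `0`
  | add_assoc {Γ : Ctx} (r s t : Tm Γ T0) :
      RCA0omega Γ (.eq (add (add r s) t) (add r (add s t)))
  | add_comm {Γ : Ctx} (r s : Tm Γ T0) : RCA0omega Γ (.eq (add r s) (add s r))
  | mul_assoc {Γ : Ctx} (r s t : Tm Γ T0) :
      RCA0omega Γ (.eq (mul (mul r s) t) (mul r (mul s t)))
  | mul_comm {Γ : Ctx} (r s : Tm Γ T0) : RCA0omega Γ (.eq (mul r s) (mul s r))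
  | mul_add {Γ : Ctx} (r s t : Tm Γ T0) :
      RCA0omega Γ (.eq (mul r (add s t)) (add (mul r s) (mul r t)))
  | add_zero {Γ : Ctx} (r : Tm Γ T0) : RCA0omega Γ (.eq (add r zero) r)
  | mul_zero {Γ : Ctx} (r : Tm Γ T0) : RCA0omega Γ (.eq (mul r zero) zero)
  | mul_one {Γ : Ctx} (r : Tm Γ T0) : RCA0omega Γ (.eq (mul r one) r)
  | lt_irrefl {Γ : Ctx} (r : Tm Γ T0) : RCA0omega Γ (Fm.lt r r).neg
  | lt_trans {Γ : Ctx} (r s t : Tm Γ T0) :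
      RCA0omega Γ ((Fm.lt r s).imp ((Fm.lt s t).imp (.lt r t)))
  | lt_total {Γ : Ctx} (r s : Tm Γ T0) :
      RCA0omega Γ ((Fm.lt r s).or ((Fm.eq r s).or (.lt s r)))
  | add_lt_add {Γ : Ctx} (r s t : Tm Γ T0) :
      RCA0omega Γ ((Fm.lt r s).imp (.lt (add r t) (add s t)))
  | mul_lt_mul {Γ : Ctx} (r s t : Tm Γ T0) :
      RCA0omega Γ ((Fm.lt zero t).imp ((Fm.lt r s).imp (.lt (mul r t) (mul s t))))
  | exists_add {Γ : Ctx} (r s : Tm Γ T0) :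
      RCA0omega Γ ((Fm.lt r s).imp (.ex T0 (.eq (add r.wk v0) s.wk)))
  | zero_lt_one {Γ : Ctx} : RCA0omega Γ (.lt zero one)
  | one_le {Γ : Ctx} (r : Tm Γ T0) : RCA0omega Γ ((Fm.lt zero r).imp (.le one r))
  | zero_le {Γ : Ctx} (r : Tm Γ T0) : RCA0omega Γ (.le zero r)
  -- the combinators `Π` and `Σ`
  | combP {Γ : Ctx} {ρ τ : Ty} (x : Tm Γ ρ) (y : Tm Γ τ) :
      RCA0omega Γ (.eqT ρ (const (.combP ρ τ) ⬝ x ⬝ y) x)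
  | combS {Γ : Ctx} {δ ρ τ : Ty} (x : Tm Γ (δ ⇾ ρ ⇾ τ)) (y : Tm Γ (δ ⇾ ρ)) (z : Tm Γ δ) :
      RCA0omega Γ (.eqT τ (const (.combS δ ρ τ) ⬝ x ⬝ y ⬝ z) (x ⬝ z ⬝ (y ⬝ z)))
  -- primitive recursion: only the recursor of type `0` has defining axioms
  | recur_zero {Γ : Ctx} (f : Tm Γ (T0 ⇾ T0 ⇾ T0)) (m : Tm Γ T0) :
      RCA0omega Γ (.eq (const (.recur T0) ⬝ f ⬝ m ⬝ zero) m)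
  | recur_succ {Γ : Ctx} (f : Tm Γ (T0 ⇾ T0 ⇾ T0)) (m n : Tm Γ T0) :
      RCA0omega Γ (.eq (const (.recur T0) ⬝ f ⬝ m ⬝ succ n)
        (f ⬝ n ⬝ (const (.recur T0) ⬝ f ⬝ m ⬝ n)))
  -- the axiom of extensionality
  | ext {Γ : Ctx} {ρ τ : Ty} (x y : Tm Γ ρ) (φ : Tm Γ (ρ ⇾ τ)) :
      RCA0omega Γ ((Fm.eqT ρ x y).imp (.eqT τ (φ ⬝ x) (φ ⬝ y)))
  -- induction for quantifier-free formulas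
  | ind {Γ : Ctx} (A : Fm (T0 :: Γ)) : A.QF →
      RCA0omega Γ (((A.inst zero).and (.all T0 (A.imp (A.subst succSubst)))).imp (.all T0 A))
  -- quantifier-free choice `QF-AC^{1,0}`
  | qfac {Γ : Ctx} (A : Fm (T0 :: T1 :: Γ)) : A.QF →
      RCA0omega Γ ((Fm.all T1 (.ex T0 A)).imp (.ex T2 (.all T1 (A.subst choiceSubst))))

/-! ## Closed sets and continuous functions on Cantor space, as coded in Reverse Mathematics

Finite binary sequences are coded bijectively by the positive numbers: `1` codes the empty sequence,
and `2c + i` codes the extension by `i ≤ 1` of the sequence with code `c`.  The sequence with code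
`c` stands for the basic clopen subset of Cantor space of its extensions.  Sets of (tuples of) numbers
are given by their characteristic functions. -/

open Tm

/-- `x ∈ 2^ℕ`, i.e. `x ≤₁ 1`. -/
def InCantor {Γ : Ctx} (x : Tm Γ T1) : Fm Γ := .all T0 (.le (x.wk ⬝ v0) one)

/-- `(∀ x ∈ 2^ℕ) A`. -/
def allCantor {Γ : Ctx} (A : Fm (T1 :: Γ)) : Fm Γ := .all T1 ((InCantor v0).imp A)

/-- The code of the finite sequence `c ⌢ ⟨x(0), …, x(k-1)⟩`, where `c` is the code of a finite binary
sequence and `x ∈ 2^ℕ`: primitive recursion from `c` with step `(n, d) ↦ (d + d) + x(n)`. -/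
def extendCode {Γ : Ctx} (c : Tm Γ T0) (x : Tm Γ T1) (k : Tm Γ T0) : Tm Γ T0 :=
  const (.recur T0) ⬝ lam (lam (add (add v0 v0) (x.wk.wk ⬝ v1))) ⬝ c ⬝ k

/-- The code of the initial segment `⟨x(0), …, x(k-1)⟩` of `x ∈ 2^ℕ`. -/
def initSeg {Γ : Ctx} (x : Tm Γ T1) (k : Tm Γ T0) : Tm Γ T0 := extendCode one x k

/-- `u` is a code of an open subset of Cantor space: a set of pairs `(n, c)`, that lists the basic
clopen sets whose union is the open set. -/
def IsOpenCode {Γ : Ctx} (u : Tm Γ (T0 ⇾ T0 ⇾ T0)) : Fm Γ :=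
  .all T0 (.all T0 (.le (u.wk.wk ⬝ v1 ⬝ v0) one))

/-- `x` belongs to the open set with code `u`: some listed basic clopen set contains `x`. -/
def MemOpen {Γ : Ctx} (u : Tm Γ (T0 ⇾ T0 ⇾ T0)) (x : Tm Γ T1) : Fm Γ :=
  .ex T0 (.ex T0 (.eq (u.wk.wk ⬝ v1 ⬝ initSeg x.wk.wk v0) one))

/-- `x` belongs to the closed set with code `u`, the complement of the open set with code `u`. -/
def MemClosed {Γ : Ctx} (u : Tm Γ (T0 ⇾ T0 ⇾ T0)) (x : Tm Γ T1) : Fm Γ := (MemOpen u x).neg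

/-- `c Φ m`, for a set `f` of triples `(i, c, m)`: some `(i, c, m)` is in `f`.  The meaning is that
the coded partial function takes the value `m` on the basic clopen set of `c`. -/
def Nbhd {Γ : Ctx} (f : Tm Γ (T0 ⇾ T0 ⇾ T0 ⇾ T0)) (c m : Tm Γ T0) : Fm Γ :=
  .ex T0 (.eq (f.wk ⬝ v0 ⬝ c.wk ⬝ m.wk) one)

/-- `f` is a code of a continuous partial function from Cantor space to the natural numbers: a set of
triples such that `c Φ m` and `c Φ m'` imply `m = m'`, and such that `c Φ m` implies `d Φ m` for all
finite binary sequences `d` that extend `c`. -/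
def IsContCode {Γ : Ctx} (f : Tm Γ (T0 ⇾ T0 ⇾ T0 ⇾ T0)) : Fm Γ :=
  (Fm.all T0 (.all T0 (.all T0 (.le (f.wk.wk.wk ⬝ v2 ⬝ v1 ⬝ v0) one)))).and
    ((Fm.all T0 ((Fm.lt zero v0).imp (.all T0 (.all T0
        ((Nbhd f.wk.wk.wk v2 v1).imp ((Nbhd f.wk.wk.wk v2 v0).imp (.eq v1 v0))))))).and
      (Fm.all T0 ((Fm.lt zero v0).imp (.all T0 (allCantor (.all T0
        ((Nbhd f.wk.wk.wk.wk v3 v2).imp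
          (Nbhd f.wk.wk.wk.wk (extendCode v3 v1 v0) v2))))))))

/-- `f(x) = m`, for the partial function with code `f`: some initial segment `c` of `x` has
`c Φ m`. -/
def HasValue {Γ : Ctx} (f : Tm Γ (T0 ⇾ T0 ⇾ T0 ⇾ T0)) (x : Tm Γ T1) (m : Tm Γ T0) : Fm Γ :=
  .ex T0 (Nbhd f.wk (initSeg x.wk v0) m.wk)

/-- `f(x)` is defined. -/
def IsDefined {Γ : Ctx} (f : Tm Γ (T0 ⇾ T0 ⇾ T0 ⇾ T0)) (x : Tm Γ T1) : Fm Γ :=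
  .ex T0 (HasValue f.wk x.wk v0)

end HigherOrderArithmetic

open HigherOrderArithmetic

/-! The complement of `D` is open by its code, and the domain of `f` is open because `f(x) = m` is
settled by an initial segment of `x`. If that domain is `D`, then for each `x ∈ 2^ℕ` exactly one of
two number searches succeeds: one for a listed neighbourhood of `x` outside `D`, one for a value of
`f`. Choice gives a functional `Y` bounding a successful search, and searching `u` up to `Y(x)`
decides whether `x ∈ D`.

Only quantifier-free choice is available, so the bounded searches must be terms. They are iterated
finite sums of characteristic functions, `openCount` and `contCount`, built from the recursor of
type 0. Such a sum is positive for some bound if the search can succeed (`openCount_pos`,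
`contCount_pos`), and 0 for every bound if it cannot (`openCount_eq_zero`, `contCount_eq_zero`).
`exists_isWitness` supplies the premise of choice; `memClosed_iff_eq_zero` verifies the resulting
`Φ(x) = openCount u x (Y(x))`. -/

namespace HigherOrderArithmetic

open Tm

/-! ## Substitution -/

/-- Extension of a substitution by a term for the most recently bound variable. -/
def consSubst {Γ Δ : Ctx} {ρ : Ty} (t : Tm Δ ρ) (θ : ∀ {σ : Ty}, Var Γ σ → Tm Δ σ) :
    ∀ {σ : Ty}, Var (ρ :: Γ) σ → Tm Δ σ
  | _, Var.vz => t
  | _, Var.vs v => θ v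

/-- The substitution from the empty context. -/
def nilSubst {Δ : Ctx} : ∀ {σ : Ty}, Var [] σ → Tm Δ σ := fun v => nomatch v

theorem Tm.subst_subst {Γ Δ Ξ : Ctx} (θ : ∀ {σ : Ty}, Var Γ σ → Tm Δ σ)
    (η : ∀ {σ : Ty}, Var Δ σ → Tm Ξ σ) {σ : Ty} (t : Tm Γ σ) :
    (t.subst θ).subst η = t.subst (fun v => (θ v).subst η) := by
  induction t with
  | var v => rfl
  | const c => rfl
  | app s t ihs iht => simp only [Tm.subst, ihs, iht]

theorem Tm.subst_var {Γ : Ctx} {σ : Ty} (t : Tm Γ σ) : t.subst (fun v => Tm.var v) = t := by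
  induction t with
  | var v => rfl
  | const c => rfl
  | app s t ihs iht => simp only [Tm.subst, ihs, iht]

theorem Tm.subst_wk {Γ Δ : Ctx} {ρ : Ty} (θ : ∀ {σ : Ty}, Var (ρ :: Γ) σ → Tm Δ σ) {σ : Ty}
    (t : Tm Γ σ) : t.wk.subst θ = t.subst (fun v => θ (Var.vs v)) :=
  Tm.subst_subst _ _ t

theorem Tm.wk_var {Γ : Ctx} {ρ σ : Ty} (v : Var Γ σ) : (var v).wk (ρ := ρ) = var v.vs := rfl

theorem Tm.wk_const {Γ : Ctx} {ρ σ : Ty} (c : Const σ) :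
    (const c : Tm Γ σ).wk (ρ := ρ) = const c := rfl

theorem Tm.wk_app {Γ : Ctx} {ρ σ τ : Ty} (s : Tm Γ (σ ⇾ τ)) (t : Tm Γ σ) :
    (s ⬝ t).wk (ρ := ρ) = s.wk ⬝ t.wk := rfl

theorem Fm.neg_wk {Γ : Ctx} {ρ : Ty} (A : Fm Γ) : A.neg.wk (ρ := ρ) = A.wk.neg := rfl

theorem Tm.wk_subst_liftSubst {Γ Δ : Ctx} {ρ : Ty} (θ : ∀ {σ : Ty}, Var Γ σ → Tm Δ σ) {σ : Ty}
    (t : Tm Γ σ) : (t.wk (ρ := ρ)).subst (liftSubst θ) = (t.subst θ).wk := by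
  rw [Tm.subst_wk, Tm.wk, Tm.subst_subst]; rfl

theorem Tm.wk_subst_instSubst {Γ : Ctx} {ρ : Ty} (r : Tm Γ ρ) {σ : Ty} (t : Tm Γ σ) :
    t.wk.subst (instSubst r) = t := by
  rw [Tm.subst_wk]; exact Tm.subst_var t

theorem Tm.wk_subst_succSubst {Γ : Ctx} {σ : Ty} (t : Tm Γ σ) :
    t.wk.subst succSubst = t.wk := by
  rw [Tm.subst_wk]; rfl

theorem Fm.eqT_subst {Γ Δ : Ctx} (θ : ∀ {σ : Ty}, Var Γ σ → Tm Δ σ) (τ : Ty) (s t : Tm Γ τ) :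
    (Fm.eqT τ s t).subst θ = Fm.eqT τ (s.subst θ) (t.subst θ) := by
  induction τ generalizing Γ Δ with
  | nat => rfl
  | arr σ τ _ ih =>
    simp only [Fm.eqT, Fm.subst]
    rw [ih]
    simp only [Tm.subst, Tm.wk_subst_liftSubst]
    rfl

/-! ## Deductions from a list of hypotheses -/

/-- `A` is provable in `RCA₀^ω` from the hypotheses in the list `L`. -/
def Entails {Γ : Ctx} (L : List (Fm Γ)) (A : Fm Γ) : Prop := Proves RCA0omega {B | B ∈ L} A

infix:45 " ⊩ " => Entails

theorem Proves.mono {T : Theory} {Γ : Ctx} {Δ Δ' : Set (Fm Γ)} {A : Fm Γ}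
    (h : Proves T Δ A) (hs : Δ ⊆ Δ') : Proves T Δ' A := by
  induction h with
  | ax h => exact .ax h
  | hyp h => exact .hyp (hs h)
  | impI _ ih => exact .impI (ih (Set.insert_subset_insert hs))
  | impE _ _ ih₁ ih₂ => exact .impE (ih₁ hs) (ih₂ hs)
  | andI _ _ ih₁ ih₂ => exact .andI (ih₁ hs) (ih₂ hs)
  | andE₁ _ ih => exact .andE₁ (ih hs)
  | andE₂ _ ih => exact .andE₂ (ih hs)
  | orI₁ _ ih => exact .orI₁ (ih hs)
  | orI₂ _ ih => exact .orI₂ (ih hs)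
  | orE _ _ _ ih₁ ih₂ ih₃ =>
    exact .orE (ih₁ hs) (ih₂ (Set.insert_subset_insert hs)) (ih₃ (Set.insert_subset_insert hs))
  | raa _ ih => exact .raa (ih (Set.insert_subset_insert hs))
  | allI _ ih => exact .allI (ih (Set.image_mono hs))
  | allE t _ ih => exact .allE t (ih hs)
  | exI t _ ih => exact .exI t (ih hs)
  | exE _ _ ih₁ ih₂ => exact .exE (ih₁ hs) (ih₂ (Set.insert_subset_insert (Set.image_mono hs)))

namespace Entails

variable {Γ : Ctx} {L : List (Fm Γ)} {A B C : Fm Γ}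

theorem ax (h : RCA0omega Γ A) : L ⊩ A := Proves.ax h

/-- Hypotheses are addressed by position, the most recently assumed one being number 0. -/
theorem hyp (n : ℕ) (h : L[n]? = some A := by rfl) : L ⊩ A :=
  Proves.hyp (List.mem_of_getElem? h)

theorem impI (h : A :: L ⊩ B) : L ⊩ A.imp B :=
  Proves.impI (Proves.mono h fun _ hB => List.mem_cons.1 hB)

theorem impE (h : L ⊩ A.imp B) (h' : L ⊩ A) : L ⊩ B := Proves.impE h h'

theorem cut (h : L ⊩ A) (h' : A :: L ⊩ B) : L ⊩ B := impE (impI h') h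

theorem andI (h : L ⊩ A) (h' : L ⊩ B) : L ⊩ A.and B := Proves.andI h h'

theorem andE₁ (h : L ⊩ A.and B) : L ⊩ A := Proves.andE₁ h

theorem andE₂ (h : L ⊩ A.and B) : L ⊩ B := Proves.andE₂ h

theorem orI₁ (h : L ⊩ A) : L ⊩ A.or B := Proves.orI₁ h

theorem orI₂ (h : L ⊩ B) : L ⊩ A.or B := Proves.orI₂ h

theorem orE (h : L ⊩ A.or B) (h₁ : A :: L ⊩ C) (h₂ : B :: L ⊩ C) : L ⊩ C :=
  Proves.orE h (Proves.mono h₁ fun _ hB => List.mem_cons.1 hB)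
    (Proves.mono h₂ fun _ hB => List.mem_cons.1 hB)

theorem raa (h : A.neg :: L ⊩ Fm.bot) : L ⊩ A :=
  Proves.raa (Proves.mono h fun _ hB => List.mem_cons.1 hB)

theorem weaken (h : L ⊩ A) : B :: L ⊩ A := Proves.mono h fun _ => List.mem_cons_of_mem _

theorem botE (h : L ⊩ Fm.bot) : L ⊩ A := raa h.weaken

theorem allI {σ : Ty} {A : Fm (σ :: Γ)} (h : L.map Fm.wk ⊩ A) : L ⊩ Fm.all σ A :=
  Proves.allI (Proves.mono h fun _ hB => List.mem_map.1 hB)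

theorem allE {σ : Ty} {A : Fm (σ :: Γ)} (t : Tm Γ σ) (h : L ⊩ Fm.all σ A) : L ⊩ A.inst t :=
  Proves.allE t h

theorem exI {σ : Ty} {A : Fm (σ :: Γ)} (t : Tm Γ σ) (h : L ⊩ A.inst t) : L ⊩ Fm.ex σ A :=
  Proves.exI t h

theorem exE {σ : Ty} {A : Fm (σ :: Γ)} (h : L ⊩ Fm.ex σ A) (h' : A :: L.map Fm.wk ⊩ C.wk) :
    L ⊩ C :=
  Proves.exE h <| Proves.mono h' fun _ hB =>
    (List.mem_cons.1 hB).imp id List.mem_map.1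

/-! ### Equality at all types -/

theorem eqT_refl {τ : Ty} (s : Tm Γ τ) : L ⊩ Fm.eqT τ s s := by
  induction τ generalizing Γ with
  | nat => exact ax (.eq_refl s)
  | arr σ τ _ ih => exact allI (ih _)

theorem eqT_app {σ τ : Ty} {s t : Tm Γ (σ ⇾ τ)} (h : L ⊩ Fm.eqT (σ ⇾ τ) s t) (r : Tm Γ σ) :
    L ⊩ Fm.eqT τ (s ⬝ r) (t ⬝ r) := by
  have := allE r h
  rw [Fm.inst, Fm.eqT_subst] at this
  simp only [Tm.subst, Tm.wk_subst_instSubst] at this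
  exact this

theorem eqT_app_var {σ τ : Ty} {s t : Tm Γ (σ ⇾ τ)} {L : List (Fm (σ :: Γ))}
    (h : L ⊩ (Fm.eqT (σ ⇾ τ) s t).wk) : L ⊩ Fm.eqT τ (s.wk ⬝ v0) (t.wk ⬝ v0) := by
  rw [Fm.wk, Fm.eqT_subst] at h
  exact eqT_app h v0

theorem eqT_symm {τ : Ty} {s t : Tm Γ τ} (h : L ⊩ Fm.eqT τ s t) : L ⊩ Fm.eqT τ t s := by
  induction τ generalizing Γ with
  | nat => exact impE (ax (.eq_symm s t)) h
  | arr σ τ _ ih => exact cut h (allI (ih (eqT_app_var (hyp 0))))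

theorem eqT_trans {τ : Ty} {s t r : Tm Γ τ} (h : L ⊩ Fm.eqT τ s t) (h' : L ⊩ Fm.eqT τ t r) :
    L ⊩ Fm.eqT τ s r := by
  induction τ generalizing Γ with
  | nat => exact impE (impE (ax (.eq_trans s t r)) h) h'
  | arr σ τ _ ih =>
    exact cut h (cut h'.weaken (allI (ih (eqT_app_var (hyp 1)) (eqT_app_var (hyp 0)))))

/-- Replacing the function is the definition of equality at an arrow type; replacing the argument is
the axiom of extensionality. -/
theorem eqT_congr {σ τ : Ty} {s s' : Tm Γ (σ ⇾ τ)} {t t' : Tm Γ σ}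
    (h : L ⊩ Fm.eqT (σ ⇾ τ) s s') (h' : L ⊩ Fm.eqT σ t t') :
    L ⊩ Fm.eqT τ (s ⬝ t) (s' ⬝ t') :=
  eqT_trans (eqT_app h t) (impE (ax (.ext t t' s')) h')

/-- `β`-reduction, under a substitution. -/
theorem beta {Ξ : Ctx} {σ : Ty} (θ : ∀ {σ : Ty}, Var Ξ σ → Tm Γ σ) (r : Tm Γ σ) :
    ∀ {τ : Ty} (t : Tm (σ :: Ξ) τ),
      L ⊩ Fm.eqT τ ((lam t).subst θ ⬝ r) (t.subst (consSubst r θ))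
  -- `Σ Π Π r = Π r (Π r) = r`.
  | _, Tm.var Var.vz => eqT_trans (ax (.combS _ _ _)) (ax (.combP _ _))
  | _, Tm.var (Var.vs _) => ax (.combP _ _)
  | _, Tm.const _ => ax (.combP _ _)
  | _, Tm.app s t => eqT_trans (ax (.combS _ _ _)) (eqT_congr (beta θ r s) (beta θ r t))

end Entails

/-! ## Arithmetic -/

namespace Entails

variable {Γ : Ctx} {L : List (Fm Γ)} {C : Fm Γ}

theorem eq_refl (r : Tm Γ T0) : L ⊩ Fm.eq r r := ax (.eq_refl r)

theorem eq_symm {r s : Tm Γ T0} (h : L ⊩ Fm.eq r s) : L ⊩ Fm.eq s r :=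
  eqT_symm (τ := T0) h

theorem eq_trans {r s t : Tm Γ T0} (h : L ⊩ Fm.eq r s) (h' : L ⊩ Fm.eq s t) : L ⊩ Fm.eq r t :=
  eqT_trans (τ := T0) h h'

theorem add_congr {r r' s s' : Tm Γ T0} (h : L ⊩ Fm.eq r r') (h' : L ⊩ Fm.eq s s') :
    L ⊩ Fm.eq (add r s) (add r' s') :=
  eqT_congr (τ := T0) (σ := T0)
    (eqT_congr (σ := T0) (τ := T0 ⇾ T0) (eqT_refl (τ := T0 ⇾ T0 ⇾ T0) (const Const.add)) h) h'

theorem lt_congr {r r' s s' : Tm Γ T0} (h : L ⊩ Fm.lt r s) (hr : L ⊩ Fm.eq r r')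
    (hs : L ⊩ Fm.eq s s') : L ⊩ Fm.lt r' s' :=
  impE (impE (impE (ax (.lt_congr r r' s s')) hr) hs) h

theorem lt_of_lt_of_eq {r s t : Tm Γ T0} (h : L ⊩ Fm.lt r s) (hs : L ⊩ Fm.eq s t) :
    L ⊩ Fm.lt r t :=
  lt_congr h (eq_refl r) hs

theorem lt_trans {r s t : Tm Γ T0} (h : L ⊩ Fm.lt r s) (h' : L ⊩ Fm.lt s t) : L ⊩ Fm.lt r t :=
  impE (impE (ax (.lt_trans r s t)) h) h'

theorem lt_irrefl {r : Tm Γ T0} (h : L ⊩ Fm.lt r r) : L ⊩ C :=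
  botE (impE (ax (.lt_irrefl r)) h)

/-- A positive number is not `0`. -/
theorem pos_elim {r : Tm Γ T0} (h : L ⊩ Fm.lt zero r) (h' : L ⊩ Fm.eq r zero) : L ⊩ C :=
  lt_irrefl (lt_of_lt_of_eq h h')

theorem pos_of_eq_one {r : Tm Γ T0} (h : L ⊩ Fm.eq r one) : L ⊩ Fm.lt zero r :=
  lt_of_lt_of_eq (ax .zero_lt_one) (eq_symm h)

theorem zero_add (r : Tm Γ T0) : L ⊩ Fm.eq (add zero r) r :=
  eq_trans (ax (.add_comm _ _)) (ax (.add_zero r))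

theorem add_pos_left {r : Tm Γ T0} (h : L ⊩ Fm.lt zero r) (s : Tm Γ T0) :
    L ⊩ Fm.lt zero (add r s) := by
  refine cut (impE (ax (.add_lt_add zero r s)) h) (orE (ax (.zero_le s)) ?_ ?_)
  · exact lt_trans (hyp 0) (lt_congr (hyp 1) (zero_add s) (eq_refl _))
  · exact lt_congr (hyp 1) (eq_trans (zero_add s) (eq_symm (hyp 0))) (eq_refl _)

theorem add_pos_right {s : Tm Γ T0} (h : L ⊩ Fm.lt zero s) (r : Tm Γ T0) :
    L ⊩ Fm.lt zero (add r s) :=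
  lt_of_lt_of_eq (add_pos_left h r) (ax (.add_comm _ _))

/-- Discreteness: a positive number is at least 1, so nothing lies strictly between 0 and 1. This
turns non-membership into the value 0 of a characteristic function. -/
theorem eq_zero_of_le_one {r : Tm Γ T0} (h : L ⊩ Fm.le r one) (h' : L ⊩ (Fm.eq r one).neg) :
    L ⊩ Fm.eq r zero := by
  refine cut h' (orE h.weaken ?_ (botE (impE (hyp 1) (hyp 0))))
  refine orE (ax (.zero_le r)) ?_ (eq_symm (hyp 0))
  exact orE (impE (ax (.one_le r)) (hyp 0)) (lt_irrefl (lt_trans (hyp 0) (hyp 2)))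
    (botE (impE (hyp 3) (eq_symm (hyp 0))))

theorem le_one_of_not_one_lt {r : Tm Γ T0} (h : L ⊩ (Fm.lt one r).neg) : L ⊩ Fm.le r one := by
  refine cut h (orE (ax (.lt_total one r)) (botE (impE (hyp 1) (hyp 0))) ?_)
  exact orE (hyp 0) (orI₂ (eq_symm (hyp 0))) (orI₁ (hyp 0))

theorem not_one_lt_of_le_one {r : Tm Γ T0} (h : L ⊩ Fm.le r one) (h' : L ⊩ Fm.lt one r) :
    L ⊩ C :=
  cut h' (orE h.weaken (lt_irrefl (lt_trans (hyp 1) (hyp 0)))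
    (lt_irrefl (lt_of_lt_of_eq (hyp 1) (hyp 0))))

/-- `(n + 1) + (a + b) = (a + 1) + (n + b)`. -/
theorem succ_add_swap (n a b : Tm Γ T0) :
    L ⊩ Fm.eq (add (succ n) (add a b)) (add (succ a) (add n b)) := by
  have h : ∀ n a : Tm Γ T0, L ⊩ Fm.eq (add (succ n) (add a b)) (add one (add (add n a) b)) := by
    intro n a
    refine eq_trans (add_congr (ax (.add_comm n one)) (eq_refl _)) (eq_trans
      (ax (.add_assoc _ _ _)) (add_congr (eq_refl _) (eq_symm (ax (.add_assoc _ _ _)))))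
  exact eq_trans (h n a) (eq_trans (add_congr (eq_refl _) (add_congr (ax (.add_comm _ _))
    (eq_refl _))) (eq_symm (h a n)))

theorem ind (A : Fm (T0 :: Γ)) (hA : A.QF) (h0 : L ⊩ A.inst zero)
    (hs : A :: L.map Fm.wk ⊩ A.subst succSubst) (t : Tm Γ T0) : L ⊩ A.inst t :=
  allE t (impE (ax (.ind A hA)) (andI h0 (allI (impI hs))))

end Entails

/-! ## Finite sums -/

/-- The step `(n, d) ↦ d + g(n)` of the recursion that defines finite sums. -/
def sumStep {Γ : Ctx} (g : Tm Γ T1) : Tm Γ (T0 ⇾ T0 ⇾ T0) :=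
  (lam (lam (add v0 (v2 ⬝ v1))) : Tm [T1] (T0 ⇾ T0 ⇾ T0)).subst (consSubst g nilSubst)

/-- The sum of `g(n)` over `n < y`. -/
def sumTo {Γ : Ctx} (g : Tm Γ T1) (y : Tm Γ T0) : Tm Γ T0 :=
  const (.recur T0) ⬝ sumStep g ⬝ zero ⬝ y

/-- The function `n ↦ ∑ k < y, w(n, k)`. -/
def innerSum {Γ : Ctx} (w : Tm Γ (T0 ⇾ T0 ⇾ T0)) (y : Tm Γ T0) : Tm Γ T1 :=
  (lam (sumTo (v2 ⬝ v0) v1) : Tm [T0, T0 ⇾ T0 ⇾ T0] T1).subst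
    (consSubst y (consSubst w nilSubst))

/-- The sum of `w(n, k)` over `n, k < y`. -/
def sumTo₂ {Γ : Ctx} (w : Tm Γ (T0 ⇾ T0 ⇾ T0)) (y : Tm Γ T0) : Tm Γ T0 := sumTo (innerSum w y) y

/-- The function `n ↦ ∑ k, l < y, w(n, k, l)`. -/
def innerSum₂ {Γ : Ctx} (w : Tm Γ (T0 ⇾ T0 ⇾ T0 ⇾ T0)) (y : Tm Γ T0) : Tm Γ T1 :=
  (lam (sumTo₂ (v2 ⬝ v0) v1) : Tm [T0, T0 ⇾ T0 ⇾ T0 ⇾ T0] T1).subst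
    (consSubst y (consSubst w nilSubst))

/-- The sum of `w(n, k, l)` over `n, k, l < y`. -/
def sumTo₃ {Γ : Ctx} (w : Tm Γ (T0 ⇾ T0 ⇾ T0 ⇾ T0)) (y : Tm Γ T0) : Tm Γ T0 :=
  sumTo (innerSum₂ w y) y

/-- The zero functional of a type. -/
def zeroOf {Γ : Ctx} : (τ : Ty) → Tm Γ τ
  | Ty.nat => zero
  | Ty.arr σ τ => const (Const.combP τ σ) ⬝ zeroOf τ

theorem zeroOf_subst {Γ Δ : Ctx} (θ : ∀ {σ : Ty}, Var Γ σ → Tm Δ σ) (τ : Ty) :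
    (zeroOf τ).subst θ = zeroOf τ := by
  induction τ with
  | nat => rfl
  | arr σ τ _ ih => simp only [zeroOf, Tm.subst, ih]

/-- `lam` does not commute with substitution: `λx. a` is `Π a` for a variable `a`, but has another
form once `a` becomes an application. Here the abstraction is formed over a fixed context and the
parameters are substituted afterwards, so later substitutions only reach the parameters. -/
theorem sumTo_subst {Γ Δ : Ctx} (θ : ∀ {σ : Ty}, Var Γ σ → Tm Δ σ) (g : Tm Γ T1) (y : Tm Γ T0) :
    (sumTo g y).subst θ = sumTo (g.subst θ) (y.subst θ) := rfl

theorem sumTo₂_subst {Γ Δ : Ctx} (θ : ∀ {σ : Ty}, Var Γ σ → Tm Δ σ)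
    (w : Tm Γ (T0 ⇾ T0 ⇾ T0)) (y : Tm Γ T0) :
    (sumTo₂ w y).subst θ = sumTo₂ (w.subst θ) (y.subst θ) := by
  rw [sumTo₂, sumTo_subst, innerSum, Tm.subst_subst]; rfl

theorem sumTo₃_subst {Γ Δ : Ctx} (θ : ∀ {σ : Ty}, Var Γ σ → Tm Δ σ)
    (w : Tm Γ (T0 ⇾ T0 ⇾ T0 ⇾ T0)) (y : Tm Γ T0) :
    (sumTo₃ w y).subst θ = sumTo₃ (w.subst θ) (y.subst θ) := by
  rw [sumTo₃, sumTo_subst, innerSum₂, Tm.subst_subst]; rfl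

namespace Entails

variable {Γ : Ctx} {L : List (Fm Γ)}

theorem zeroOf_app {σ τ : Ty} {t : Tm Γ (σ ⇾ τ)} (h : L ⊩ Fm.eqT (σ ⇾ τ) t (zeroOf (σ ⇾ τ)))
    (r : Tm Γ σ) : L ⊩ Fm.eqT τ (t ⬝ r) (zeroOf τ) :=
  eqT_trans (eqT_app h r) (ax (.combP _ _))

/-- Equality with `zeroOf` says in one formula that a function of several arguments vanishes
identically, the form in which vanishing passes through nested sums. -/
theorem eqT_zeroOf {σ τ : Ty} {t : Tm Γ (σ ⇾ τ)}
    (h : L.map Fm.wk ⊩ Fm.eqT τ (t.wk ⬝ v0) (zeroOf τ)) :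
    L ⊩ Fm.eqT (σ ⇾ τ) t (zeroOf (σ ⇾ τ)) := by
  refine allI (eqT_trans h (eqT_symm ?_))
  have : (zeroOf (σ ⇾ τ) : Tm Γ _).wk (ρ := σ) = zeroOf (σ ⇾ τ) := zeroOf_subst _ _
  rw [this]
  exact ax (.combP _ _)

theorem hyp_zeroOf {τ ρ : Ty} {t : Tm Γ τ} {L : List (Fm (ρ :: Γ))}
    (h : L ⊩ (Fm.eqT τ t (zeroOf τ)).wk) : L ⊩ Fm.eqT τ t.wk (zeroOf τ) := by
  rw [Fm.wk, Fm.eqT_subst, zeroOf_subst] at h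
  exact h

theorem sumTo_zero (g : Tm Γ T1) : L ⊩ Fm.eq (sumTo g zero) zero := ax (.recur_zero _ _)

theorem sumTo_succ (g : Tm Γ T1) (n : Tm Γ T0) :
    L ⊩ Fm.eq (sumTo g (succ n)) (add (sumTo g n) (g ⬝ n)) :=
  eq_trans (ax (.recur_succ _ _ _)) <|
    eq_trans (eqT_app (σ := T0) (τ := T0) (beta (τ := T0 ⇾ T0) _ n _) (sumTo g n)) <|
      beta (τ := T0) (consSubst n (consSubst g nilSubst)) (sumTo g n) (add v0 (v2 ⬝ v1))

theorem sumTo_congr (g : Tm Γ T1) {y z : Tm Γ T0} (h : L ⊩ Fm.eq y z) :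
    L ⊩ Fm.eq (sumTo g y) (sumTo g z) :=
  impE (ax (.ext (ρ := T0) (τ := T0) y z _)) h

theorem sumTo_eq_zero {g : Tm Γ T1} (h : L ⊩ Fm.eqT T1 g (zeroOf T1)) (y : Tm Γ T0) :
    L ⊩ Fm.eq (sumTo g y) zero := by
  refine cut h ?_
  -- The vanishing of `g` is a universal statement; kept among the hypotheses, it leaves the
  -- induction formula quantifier-free.
  have key := ind (L := Fm.eqT T1 g (zeroOf T1) :: L) (Fm.eq (sumTo g.wk v0) zero) trivial
    ?_ ?_ y
  · simp only [Fm.inst, Fm.subst, sumTo_subst, wk_subst_instSubst] at key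
    exact key
  · simp only [Fm.inst, Fm.subst, sumTo_subst, wk_subst_instSubst]
    exact sumTo_zero g
  · simp only [Fm.subst, sumTo_subst, wk_subst_succSubst]
    refine eq_trans (sumTo_succ g.wk v0) (eq_trans (add_congr (hyp 0) ?_) (ax (.add_zero _)))
    exact zeroOf_app (τ := T0) (hyp_zeroOf (τ := T1) (hyp 1)) v0

/-- `y = (n + 1) + d` expresses `n < y` without a quantifier. Induction on `d`: the sum below `n +
1` ends with the positive term `g(n)`, and further terms cannot destroy positivity. -/
theorem sumTo_pos {g : Tm Γ T1} {n y d : Tm Γ T0} (h : L ⊩ Fm.lt zero (g ⬝ n))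
    (hy : L ⊩ Fm.eq y (add (succ n) d)) : L ⊩ Fm.lt zero (sumTo g y) := by
  refine lt_of_lt_of_eq ?_ (sumTo_congr g (eq_symm hy))
  have key := ind (L := L) (Fm.lt zero (sumTo g.wk (add (succ n).wk v0))) trivial ?_ ?_ d
  · simp only [Fm.inst, Fm.subst, sumTo_subst, Tm.subst, wk_subst_instSubst] at key
    exact key
  · simp only [Fm.inst, Fm.subst, sumTo_subst, Tm.subst, wk_subst_instSubst]
    refine lt_of_lt_of_eq ?_ (sumTo_congr g (eq_symm (ax (.add_zero _))))
    exact lt_of_lt_of_eq (add_pos_right h _) (eq_symm (sumTo_succ g n))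
  · simp only [Fm.subst, sumTo_subst, Tm.subst, wk_subst_succSubst]
    refine lt_of_lt_of_eq (add_pos_left (hyp 0) _) (eq_symm (eq_trans ?_ (sumTo_succ _ _)))
    exact sumTo_congr _ (eq_symm (ax (.add_assoc _ _ _)))

theorem innerSum_app (w : Tm Γ (T0 ⇾ T0 ⇾ T0)) (y n : Tm Γ T0) :
    L ⊩ Fm.eq (innerSum w y ⬝ n) (sumTo (w ⬝ n) y) := beta (τ := T0) _ n _

theorem innerSum₂_app (w : Tm Γ (T0 ⇾ T0 ⇾ T0 ⇾ T0)) (y n : Tm Γ T0) :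
    L ⊩ Fm.eq (innerSum₂ w y ⬝ n) (sumTo₂ (w ⬝ n) y) := beta (τ := T0) _ n _

theorem sumTo₂_pos {w : Tm Γ (T0 ⇾ T0 ⇾ T0)} {n k y d e : Tm Γ T0}
    (h : L ⊩ Fm.lt zero (w ⬝ n ⬝ k)) (hn : L ⊩ Fm.eq y (add (succ n) d))
    (hk : L ⊩ Fm.eq y (add (succ k) e)) : L ⊩ Fm.lt zero (sumTo₂ w y) :=
  sumTo_pos (lt_of_lt_of_eq (sumTo_pos h hk) (eq_symm (innerSum_app w y n))) hn

theorem sumTo₃_pos {w : Tm Γ (T0 ⇾ T0 ⇾ T0 ⇾ T0)} {n k l y d e c : Tm Γ T0}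
    (h : L ⊩ Fm.lt zero (w ⬝ n ⬝ k ⬝ l)) (hn : L ⊩ Fm.eq y (add (succ n) d))
    (hk : L ⊩ Fm.eq y (add (succ k) e)) (hl : L ⊩ Fm.eq y (add (succ l) c)) :
    L ⊩ Fm.lt zero (sumTo₃ w y) :=
  sumTo_pos (lt_of_lt_of_eq (sumTo₂_pos h hk hl) (eq_symm (innerSum₂_app w y n))) hn

theorem sumTo₂_eq_zero {w : Tm Γ (T0 ⇾ T0 ⇾ T0)}
    (h : L ⊩ Fm.eqT (T0 ⇾ T0 ⇾ T0) w (zeroOf (T0 ⇾ T0 ⇾ T0))) (y : Tm Γ T0) :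
    L ⊩ Fm.eq (sumTo₂ w y) zero := by
  refine sumTo_eq_zero (cut h (eqT_zeroOf (τ := T0) ?_)) y
  refine eq_trans (innerSum_app w.wk y.wk v0) (sumTo_eq_zero (zeroOf_app ?_ v0) _)
  exact hyp_zeroOf (τ := T0 ⇾ T0 ⇾ T0) (hyp 0)

theorem sumTo₃_eq_zero {w : Tm Γ (T0 ⇾ T0 ⇾ T0 ⇾ T0)}
    (h : L ⊩ Fm.eqT (T0 ⇾ T0 ⇾ T0 ⇾ T0) w (zeroOf (T0 ⇾ T0 ⇾ T0 ⇾ T0))) (y : Tm Γ T0) :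
    L ⊩ Fm.eq (sumTo₃ w y) zero := by
  refine sumTo_eq_zero (cut h (eqT_zeroOf (τ := T0) ?_)) y
  refine eq_trans (innerSum₂_app w.wk y.wk v0) (sumTo₂_eq_zero (zeroOf_app ?_ v0) _)
  exact hyp_zeroOf (τ := T0 ⇾ T0 ⇾ T0 ⇾ T0) (hyp 0)

end Entails

/-! ## Bounded search through codes -/

/-- The function `(n, k) ↦ u(n, ⟨x(0), …, x(k-1)⟩)`. -/
def openEval {Γ : Ctx} (u : Tm Γ (T0 ⇾ T0 ⇾ T0)) (x : Tm Γ T1) : Tm Γ (T0 ⇾ T0 ⇾ T0) :=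
  (lam (lam (v3 ⬝ v1 ⬝ initSeg v2 v0)) : Tm [T1, T0 ⇾ T0 ⇾ T0] (T0 ⇾ T0 ⇾ T0)).subst
    (consSubst x (consSubst u nilSubst))

/-- The function `(m, k, i) ↦ f(i, ⟨x(0), …, x(k-1)⟩, m)`. -/
def contEval {Γ : Ctx} (f : Tm Γ (T0 ⇾ T0 ⇾ T0 ⇾ T0)) (x : Tm Γ T1) :
    Tm Γ (T0 ⇾ T0 ⇾ T0 ⇾ T0) :=
  (lam (lam (lam (v4 ⬝ v0 ⬝ initSeg v3 v1 ⬝ v2))) :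
    Tm [T1, T0 ⇾ T0 ⇾ T0 ⇾ T0] (T0 ⇾ T0 ⇾ T0 ⇾ T0)).subst
    (consSubst x (consSubst f nilSubst))

theorem openEval_subst {Γ Δ : Ctx} (θ : ∀ {σ : Ty}, Var Γ σ → Tm Δ σ)
    (u : Tm Γ (T0 ⇾ T0 ⇾ T0)) (x : Tm Γ T1) :
    (openEval u x).subst θ = openEval (u.subst θ) (x.subst θ) := by
  rw [openEval, Tm.subst_subst]; rfl

theorem contEval_subst {Γ Δ : Ctx} (θ : ∀ {σ : Ty}, Var Γ σ → Tm Δ σ)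
    (f : Tm Γ (T0 ⇾ T0 ⇾ T0 ⇾ T0)) (x : Tm Γ T1) :
    (contEval f x).subst θ = contEval (f.subst θ) (x.subst θ) := by
  rw [contEval, Tm.subst_subst]; rfl

/-- The number of `n, k < y` with `(n, ⟨x(0), …, x(k-1)⟩)` in the code `u`. -/
def openCount {Γ : Ctx} (u : Tm Γ (T0 ⇾ T0 ⇾ T0)) (x : Tm Γ T1) (y : Tm Γ T0) : Tm Γ T0 :=
  sumTo₂ (openEval u x) y

/-- The number of `m, k, i < y` with `(i, ⟨x(0), …, x(k-1)⟩, m)` in the code `f`. -/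
def contCount {Γ : Ctx} (f : Tm Γ (T0 ⇾ T0 ⇾ T0 ⇾ T0)) (x : Tm Γ T1) (y : Tm Γ T0) : Tm Γ T0 :=
  sumTo₃ (contEval f x) y

theorem openCount_subst {Γ Δ : Ctx} (θ : ∀ {σ : Ty}, Var Γ σ → Tm Δ σ)
    (u : Tm Γ (T0 ⇾ T0 ⇾ T0)) (x : Tm Γ T1) (y : Tm Γ T0) :
    (openCount u x y).subst θ = openCount (u.subst θ) (x.subst θ) (y.subst θ) := by
  rw [openCount, openCount, sumTo₂_subst, openEval_subst]

theorem contCount_subst {Γ Δ : Ctx} (θ : ∀ {σ : Ty}, Var Γ σ → Tm Δ σ)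
    (f : Tm Γ (T0 ⇾ T0 ⇾ T0 ⇾ T0)) (x : Tm Γ T1) (y : Tm Γ T0) :
    (contCount f x y).subst θ = contCount (f.subst θ) (x.subst θ) (y.subst θ) := by
  rw [contCount, contCount, sumTo₃_subst, contEval_subst]

theorem MemClosed_wk {Γ : Ctx} {ρ : Ty} (u : Var Γ (T0 ⇾ T0 ⇾ T0)) (x : Var Γ T1) :
    (MemClosed (var u) (var x)).wk (ρ := ρ) = MemClosed (var u.vs) (var x.vs) := rfl

theorem IsDefined_wk {Γ : Ctx} {ρ : Ty} (f : Var Γ (T0 ⇾ T0 ⇾ T0 ⇾ T0)) (x : Var Γ T1) :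
    (IsDefined (var f) (var x)).wk (ρ := ρ) = IsDefined (var f.vs) (var x.vs) := rfl

theorem IsOpenCode_wk {Γ : Ctx} {ρ : Ty} (u : Var Γ (T0 ⇾ T0 ⇾ T0)) :
    (IsOpenCode (var u)).wk (ρ := ρ) = IsOpenCode (var u.vs) := rfl

theorem IsContCode_wk {Γ : Ctx} {ρ : Ty} (f : Var Γ (T0 ⇾ T0 ⇾ T0 ⇾ T0)) :
    (IsContCode (var f)).wk (ρ := ρ) = IsContCode (var f.vs) := rfl

namespace Entails

variable {Γ : Ctx} {L : List (Fm Γ)}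

theorem inst {σ : Ty} {A : Fm (σ :: Γ)} {B : Fm Γ} (t : Tm Γ σ) (h : L ⊩ Fm.all σ A)
    (hB : A.inst t = B := by rfl) : L ⊩ B := hB ▸ allE t h

/-- Here `x` is a variable because `initSeg` abstracts over a term containing `x`; for a compound
`x` the two sides would contain syntactically different combinator terms. -/
theorem openEval_app (u : Tm Γ (T0 ⇾ T0 ⇾ T0)) (x : Var Γ T1) (n k : Tm Γ T0) :
    L ⊩ Fm.eq (openEval u (var x) ⬝ n ⬝ k) (u ⬝ n ⬝ initSeg (var x) k) :=
  eq_trans (eqT_app (σ := T0) (τ := T0) (beta (τ := T0 ⇾ T0) _ n _) k) <|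
    beta (τ := T0) (consSubst n (consSubst (var x) (consSubst u nilSubst))) k
      (v3 ⬝ v1 ⬝ initSeg v2 v0)

theorem contEval_app (f : Tm Γ (T0 ⇾ T0 ⇾ T0 ⇾ T0)) (x : Var Γ T1) (m k i : Tm Γ T0) :
    L ⊩ Fm.eq (contEval f (var x) ⬝ m ⬝ k ⬝ i) (f ⬝ i ⬝ initSeg (var x) k ⬝ m) :=
  eq_trans
    (eqT_app (σ := T0) (τ := T0)
      (eqT_app (σ := T0) (τ := T0 ⇾ T0) (beta (τ := T0 ⇾ T0 ⇾ T0) _ m _) k) i) <|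
    eq_trans
      (eqT_app (σ := T0) (τ := T0)
        (beta (τ := T0 ⇾ T0) (consSubst m (consSubst (var x) (consSubst f nilSubst))) k
          (lam (v4 ⬝ v0 ⬝ initSeg v3 v1 ⬝ v2))) i) <|
      beta (τ := T0) (consSubst k (consSubst m (consSubst (var x) (consSubst f nilSubst)))) i
        (v4 ⬝ v0 ⬝ initSeg v3 v1 ⬝ v2)

theorem memOpen_intro {u : Var Γ (T0 ⇾ T0 ⇾ T0)} {x : Var Γ T1} (n k : Tm Γ T0)
    (h : L ⊩ Fm.eq (var u ⬝ n ⬝ initSeg (var x) k) one) : L ⊩ MemOpen (var u) (var x) := by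
  refine exI n (exI k ?_)
  convert h using 1
  simp only [Fm.inst, Fm.subst, Tm.subst, initSeg, extendCode, lam, wk_var, liftSubst, instSubst,
    wk_subst_instSubst]

theorem isDefined_intro {f : Var Γ (T0 ⇾ T0 ⇾ T0 ⇾ T0)} {x : Var Γ T1} (m k i : Tm Γ T0)
    (h : L ⊩ Fm.eq (var f ⬝ i ⬝ initSeg (var x) k ⬝ m) one) :
    L ⊩ IsDefined (var f) (var x) := by
  refine exI m (exI k (exI i ?_))
  convert h using 1
  simp only [Fm.inst, Fm.subst, Tm.subst, initSeg, extendCode, lam, wk_var, liftSubst, instSubst,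
    wk_subst_instSubst, wk_subst_liftSubst, wk_const, wk_app]

attribute [local irreducible] openEval contEval sumTo₂ sumTo₃

/-- Every summand is a value of a characteristic function that is never 1 on initial segments of
`x`, hence is 0. -/
theorem openCount_eq_zero {u : Var Γ (T0 ⇾ T0 ⇾ T0)} {x : Var Γ T1}
    (hu : L ⊩ IsOpenCode (var u)) (h : L ⊩ MemClosed (var u) (var x)) (y : Tm Γ T0) :
    L ⊩ Fm.eq (openCount (var u) (var x) y) zero := by
  refine sumTo₂_eq_zero ?_ y
  refine cut hu (cut h.weaken (eqT_zeroOf (τ := T0 ⇾ T0) (eqT_zeroOf (τ := T0) ?_)))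
  simp only [List.map, MemClosed_wk, IsOpenCode_wk, wk, Tm.subst, openEval_subst]
  refine eq_trans (openEval_app (var u.vs.vs) x.vs.vs v1 v0) (eq_zero_of_le_one ?_ (impI ?_))
  · exact inst (initSeg (var x.vs.vs) v0) (inst v1 (hyp 1))
  · exact impE (hyp 1) (memOpen_intro v1 v0 (hyp 0))

theorem contCount_eq_zero {f : Var Γ (T0 ⇾ T0 ⇾ T0 ⇾ T0)} {x : Var Γ T1}
    (hf : L ⊩ IsContCode (var f)) (h : L ⊩ (IsDefined (var f) (var x)).neg) (y : Tm Γ T0) :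
    L ⊩ Fm.eq (contCount (var f) (var x) y) zero := by
  refine sumTo₃_eq_zero ?_ y
  refine cut hf (cut h.weaken (eqT_zeroOf (τ := T0 ⇾ T0 ⇾ T0)
    (eqT_zeroOf (τ := T0 ⇾ T0) (eqT_zeroOf (τ := T0) ?_))))
  simp only [List.map, Fm.neg_wk, IsDefined_wk, IsContCode_wk, wk, Tm.subst, contEval_subst]
  refine eq_trans (contEval_app (var f.vs.vs.vs) x.vs.vs.vs v2 v1 v0)
    (eq_zero_of_le_one ?_ (impI ?_))
  -- `v2, v1, v0` are `m, k, i`, the order of the existential quantifiers in `IsDefined`; the code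
  -- takes its arguments in the order `i, c, m`.
  · exact inst v2 (inst (initSeg (var x.vs.vs.vs) v1) (inst v0 (andE₁ (hyp 1))))
  · exact impE (hyp 1) (isDefined_intro v2 v1 v0 (hyp 0))

theorem openCount_pos {u : Var Γ (T0 ⇾ T0 ⇾ T0)} {x : Var Γ T1}
    (h : L ⊩ MemOpen (var u) (var x)) :
    L ⊩ Fm.ex T0 (Fm.lt zero (openCount (var u.vs) (var x.vs) v0)) := by
  -- With `n, k` the witnesses, the bound `(n + 1) + k` exceeds both, by offsets `k` and `n`.
  refine exE h (exE (hyp 0) (exI (add (succ v1) v0) ?_))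
  simp only [Fm.inst, Fm.subst, openCount_subst]
  refine sumTo₂_pos (n := v1) (k := v0) (d := v0) (e := v1) ?_ (eq_refl _) ?_
  · exact lt_of_lt_of_eq (pos_of_eq_one (hyp 0))
      (eq_symm (openEval_app (var u.vs.vs) x.vs.vs v1 v0))
  · exact eq_trans (add_congr (eq_refl _) (eq_symm (ax (.add_zero _)))) (eq_trans
      (succ_add_swap _ _ _) (add_congr (eq_refl _) (ax (.add_zero _))))

theorem contCount_pos {f : Var Γ (T0 ⇾ T0 ⇾ T0 ⇾ T0)} {x : Var Γ T1}
    (h : L ⊩ IsDefined (var f) (var x)) :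
    L ⊩ Fm.ex T0 (Fm.lt zero (contCount (var f.vs) (var x.vs) v0)) := by
  -- The bound `(m + 1) + (k + i)` exceeds `m`, `k` and `i`, with offsets `k + i`, `m + i` and `m +
  -- k`.
  refine exE h (exE (hyp 0) (exE (hyp 0) (exI (add (succ v2) (add v1 v0)) ?_)))
  simp only [Fm.inst, Fm.subst, contCount_subst]
  refine sumTo₃_pos (n := v2) (k := v1) (l := v0) (d := add v1 v0) (e := add v2 v0)
    (c := add v2 v1) ?_ (eq_refl _) (succ_add_swap _ _ _) ?_
  · exact lt_of_lt_of_eq (pos_of_eq_one (hyp 0))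
      (eq_symm (contEval_app (var f.vs.vs.vs) x.vs.vs.vs v2 v1 v0))
  · exact eq_trans (add_congr (eq_refl _) (ax (.add_comm _ _))) (succ_add_swap _ _ _)

end Entails

/-! ## Decidability -/

/-- The number `y` witnesses that `x` is not in Cantor space, or bounds a witness that `x` is in the
open set with code `u`, or bounds a witness that `f(x)` is defined. -/
def IsWitness {Γ : Ctx} (u : Tm Γ (T0 ⇾ T0 ⇾ T0)) (f : Tm Γ (T0 ⇾ T0 ⇾ T0 ⇾ T0)) (x : Tm Γ T1)
    (y : Tm Γ T0) : Fm Γ :=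
  (Fm.lt one (x ⬝ y)).or
    ((Fm.lt zero (openCount u x y)).or (Fm.lt zero (contCount f x y)))

theorem IsWitness_subst {Γ Δ : Ctx} (θ : ∀ {σ : Ty}, Var Γ σ → Tm Δ σ) (u : Tm Γ (T0 ⇾ T0 ⇾ T0))
    (f : Tm Γ (T0 ⇾ T0 ⇾ T0 ⇾ T0)) (x : Tm Γ T1) (y : Tm Γ T0) :
    (IsWitness u f x y).subst θ =
      IsWitness (u.subst θ) (f.subst θ) (x.subst θ) (y.subst θ) := by
  simp only [IsWitness, Fm.subst, openCount_subst, contCount_subst, Tm.subst]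

attribute [local irreducible] openCount contCount

namespace Entails

variable {Γ : Ctx} {L : List (Fm Γ)} {u : Var Γ (T0 ⇾ T0 ⇾ T0)}
  {f : Var Γ (T0 ⇾ T0 ⇾ T0 ⇾ T0)} {x : Var Γ T1}

/-- Choice ranges over all `x` of type 1, and `x ∈ 2^ℕ` is not quantifier-free; the disjunct `1 <
x(y)` absorbs the other `x`. Without any witness, `x` would be in `2^ℕ` and in `D`, so `f(x)` would
be defined and a bound on that search would be a witness. -/
theorem exists_isWitness (h : L ⊩ (InCantor (var x)).imp
      ((MemClosed (var u) (var x)).iff (IsDefined (var f) (var x)))) :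
    L ⊩ Fm.ex T0 (IsWitness (var u.vs) (var f.vs) (var x.vs) v0) := by
  refine raa ?_
  have intro_witness : ∀ (Δ : Ctx) (M : List (Fm Δ)) (u : Var Δ (T0 ⇾ T0 ⇾ T0))
      (f : Var Δ (T0 ⇾ T0 ⇾ T0 ⇾ T0)) (x : Var Δ T1) (y : Tm Δ T0),
      M ⊩ IsWitness (var u) (var f) (var x) y →
      M ⊩ Fm.ex T0 (IsWitness (var u.vs) (var f.vs) (var x.vs) v0) := by
    intro Δ M u f x y h
    refine exI y ?_
    rw [Fm.inst, IsWitness_subst]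
    exact h
  have hwk : ∀ ρ : Ty, (Fm.ex T0 (IsWitness (var u.vs) (var f.vs) (var x.vs) v0)).neg.wk (ρ := ρ) =
      (Fm.ex T0 (IsWitness (var u.vs.vs) (var f.vs.vs) (var x.vs.vs) v0)).neg := by
    intro ρ
    simp only [Fm.neg, Fm.wk, Fm.subst, IsWitness_subst]
    rfl
  have hx : (Fm.ex T0 (IsWitness (var u.vs) (var f.vs) (var x.vs) v0)).neg :: L ⊩
      InCantor (var x) := by
    refine allI (le_one_of_not_one_lt (impI ?_))
    simp only [List.map, hwk]
    exact impE (hyp 1) (intro_witness _ _ _ _ _ v0 (orI₁ (hyp 0)))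
  have hD : (Fm.ex T0 (IsWitness (var u.vs) (var f.vs) (var x.vs) v0)).neg :: L ⊩
      MemClosed (var u) (var x) := by
    refine impI (exE (openCount_pos (hyp 0)) ?_)
    simp only [List.map, hwk]
    exact impE (hyp 2) (intro_witness _ _ _ _ _ v0 (orI₂ (orI₁ (hyp 0))))
  refine exE (contCount_pos (impE (andE₁ (impE h.weaken hx)) hD)) ?_
  simp only [List.map, hwk]
  exact impE (hyp 1) (intro_witness _ _ _ _ _ v0 (orI₂ (orI₂ (hyp 0))))

theorem memClosed_iff_eq_zero {Y Φ : Var Γ T2} (hu : L ⊩ IsOpenCode (var u))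
    (hf : L ⊩ IsContCode (var f)) (hx : L ⊩ InCantor (var x))
    (h : L ⊩ (InCantor (var x)).imp
      ((MemClosed (var u) (var x)).iff (IsDefined (var f) (var x))))
    (hY : L ⊩ IsWitness (var u) (var f) (var x) (var Y ⬝ var x))
    (hΦ : L ⊩ Fm.eq (openCount (var u) (var x) (var Y ⬝ var x)) (var Φ ⬝ var x)) :
    L ⊩ (MemClosed (var u) (var x)).iff (Fm.eq (var Φ ⬝ var x) zero) := by
  -- For the converse, `f(x)` is assumed undefined: each of the three ways in which `Y(x)` can be a
  -- witness is then refuted, by `x ∈ 2^ℕ`, by `Φ(x) = 0`, and by this assumption.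
  refine andI (impI (eq_trans (eq_symm hΦ.weaken) (openCount_eq_zero hu.weaken (hyp 0) _)))
    (impI (impE (andE₂ (impE h.weaken hx.weaken)) (raa (orE hY.weaken.weaken ?_
      (orE (hyp 0) ?_ ?_)))))
  · exact not_one_lt_of_le_one (allE _ hx.weaken.weaken.weaken) (hyp 0)
  · exact pos_elim (hyp 0) (eq_trans hΦ.weaken.weaken.weaken.weaken (hyp 3))
  · exact pos_elim (hyp 0) (contCount_eq_zero hf.weaken.weaken.weaken.weaken (hyp 2) _)

end Entails

end HigherOrderArithmetic


-- The main theorem, by two applications of quantifier-free choice.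

attribute [local irreducible] openCount contCount in
open Entails in
theorem theorem2p4 :
    Proves RCA0omega (∅ : Set (Fm []))
      (.all (T0 ⇾ T0 ⇾ T0) (.all (T0 ⇾ T0 ⇾ T0 ⇾ T0)
        (((IsOpenCode Tm.v1).and (IsContCode Tm.v0)).imp
          ((allCantor ((MemClosed Tm.v2 Tm.v0).iff (IsDefined Tm.v1 Tm.v0))).imp
            (.ex T2 (allCantor
              ((MemClosed Tm.v3 Tm.v0).iff (.eq (Tm.v1 ⬝ Tm.v0) Tm.zero)))))))) := by
  suffices h : Entails [] _ from Proves.mono h (by simp)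
  refine allI (allI (impI (impI ?_)))
  refine exE (impE (ax (.qfac (IsWitness Tm.v3 Tm.v2 Tm.v1 Tm.v0) ?_))
    (allI (exists_isWitness (inst Tm.v0 (hyp 0))))) ?_
  · exact ⟨trivial, trivial, trivial⟩
  -- With `Y` at hand, a second choice, applied to an equation with an explicit solution, yields
  -- `Φ(x) = openCount u x (Y(x))` without abstracting over `x`.
  refine exE (impE (ax (.qfac (.eq (openCount Tm.v4 Tm.v1 (Tm.v2 ⬝ Tm.v1)) Tm.v0) trivial))
    (allI (exI (openCount Tm.v3 Tm.v0 (Tm.v1 ⬝ Tm.v0)) ?_))) ?_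
  · simp only [Fm.inst, Fm.subst, openCount_subst]
    exact eq_refl _
  refine exI Tm.v0 (allI (impI ?_))
  -- Hypotheses 0 to 4: `x ∈ 2^ℕ`, the equation for `Φ`, the witness property of `Y`, the assumed
  -- equivalence, and the conditions on the codes.
  refine memClosed_iff_eq_zero (u := .vs (.vs (.vs (.vs .vz)))) (f := .vs (.vs (.vs .vz)))
    (x := .vz) (Y := .vs (.vs .vz)) (Φ := .vs .vz) ?_ ?_ ?_ ?_ ?_ ?_
  · exact andE₁ (hyp 4)
  · exact andE₂ (hyp 4)
  · exact hyp 0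
  · exact inst Tm.v0 (hyp 3)
  · refine inst Tm.v0 (hyp 2) ?_
    simp only [Fm.inst, IsWitness_subst]
    rfl
  · refine inst Tm.v0 (hyp 1) ?_
    simp only [Fm.inst, Fm.subst, openCount_subst]
    rfl
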